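/- All matroids are finite. For positive integers $t$ and $\ell$, a matroid $M$ has the *$(t,\ell)$-property* if every $t$-element subset of $E(M)$ is contained both in an $\ell$-element circuit of $M$ and in an $\ell$-element cocircuit of $M$. A matroid $M$ is a *$t$-spike* if, for some integer $r \ge t$, the ground set $E(M)$ has a partition $(A_1,\dots,A_r)$ into two-element sets such that, for every $I \subseteq \{1,\dots,r\}$ with $|I| = t$, the set $\bigcup_{i\in I} A_i$ is both a circuit and a cocircuit of $M$. **Theorem.** There is a function $f : \mathbb{N} \to \mathbb{N}$ such that, for every positive integer $t$, every matroid $M$ with the $(t,2t)$-property and $|E(M)| \ge f(t)$ is a $t$-spike. -/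

import Mathlib

namespace Matroid

/-- The `(t, ℓ)`-property: every `t`-element subset of the ground set is contained both in an
`ℓ`-element circuit and in an `ℓ`-element cocircuit. -/
def HasCircuitCocircuitProperty {α : Type*} (M : Matroid α) (t ℓ : ℕ) : Prop :=
  ∀ X : Set α, X ⊆ M.E → X.encard = t →
    (∃ C : Set α, M.IsCircuit C ∧ C.encard = ℓ ∧ X ⊆ C) ∧
    (∃ K : Set α, M.IsCocircuit K ∧ K.encard = ℓ ∧ X ⊆ K)

/-- A `t`-echidna of order `n`: a partition `(S₁, …, Sₙ)` of a subset of the ground set into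
pairs such that the union of any `t` of the pairs is a circuit. -/
structure IsEchidna {α : Type*} (M : Matroid α) (t n : ℕ) (S : Fin n → Set α) : Prop where
  subset_ground : ∀ i, S i ⊆ M.E
  pairwise_disjoint : ∀ i j, i ≠ j → Disjoint (S i) (S j)
  encard_eq_two : ∀ i, (S i).encard = 2
  isCircuit_iUnion : ∀ I : Finset (Fin n), I.card = t → M.IsCircuit (⋃ i ∈ I, S i)

/-- A `t`-coechidna of `M` is a `t`-echidna of the dual of `M`. -/
def IsCoechidna {α : Type*} (M : Matroid α) (t n : ℕ) (S : Fin n → Set α) : Prop :=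
  M✶.IsEchidna t n S

/-- `M` is a `t`-spike: for some `r ≥ t`, the ground set has a partition into `r` pairs that is
both a `t`-echidna and a `t`-coechidna. -/
def IsTSpike {α : Type*} (M : Matroid α) (t : ℕ) : Prop :=
  ∃ r : ℕ, t ≤ r ∧ ∃ A : Fin r → Set α,
    (⋃ i, A i) = M.E ∧ M.IsEchidna t r A ∧ M.IsCoechidna t r A

end Matroid

open Set

/-! ### Disjoint circuits chosen greedily. -/

namespace Matroid

variable {α : Type*} {M : Matroid α}

/-! The engine is orthogonality: a circuit and a cocircuit never meet in exactly one element. A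
large matroid whose elements all lie in circuits of bounded size has many disjoint circuits `C i`.
Take one element from each of the first `t - 1` of them and one from a later `C j`. A `2t`-element
cocircuit through these meets each of the `t` circuits at least twice, hence exactly twice. By
pigeonhole, many `j` give cocircuits `P ∪ {c j, x j}` with the same `P`
(`exists_common_part_of_cocircuits`).

A rank count in the dual turns these into cocircuits made of whole pairs, flexible enough that for
most `j` one contains `{c j, x j}` and otherwise avoids any prescribed small set
(`exists_subset_forall_isCircuit_avoiding`). Orthogonality then makes the pair circuit-linked
(`exists_linked_pairs`). So the union of any `t` such pairs is a circuit, and with `3t` pairs the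
dual statement follows (`isCircuitLinked_dual`). Finally, every element outside such a family has a
partner with which it extends the family (`IsSpikeFamily.exists_insert`), so a maximal family covers
the ground set. -/

/-- Adjoining a circuit `C` not contained in `W` adds `|C \ W|` elements but raises the rank by at
most `|C \ W| - 1`, so the nullity grows with each of the `n` steps. -/
lemma exists_superset_eRk_add_le [M.Finite] {k : ℕ} (hk : 1 ≤ k)
    (hcov : ∀ e ∈ M.E, ∃ C, M.IsCircuit C ∧ e ∈ C ∧ C.ncard ≤ k) {Y : Set α} (hY : Y ⊆ M.E)
    (n : ℕ) (hE : Y.ncard + k * n ≤ M.E.ncard) :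
    ∃ W, Y ⊆ W ∧ W ⊆ M.E ∧ W.ncard ≤ Y.ncard + k * n ∧ ∃ r : ℕ, M.eRk W ≤ r ∧ r + n ≤ W.ncard := by
  induction n with
  | zero =>
    have hfin := M.set_finite Y hY
    exact ⟨Y, Subset.rfl, hY, by simp, Y.ncard, by
      rw [hfin.cast_ncard_eq]; exact M.eRk_le_encard Y, by simp⟩
  | succ n ih =>
    rw [mul_add, mul_one] at hE ⊢
    obtain ⟨W, hYW, hWE, hWc, r, hr, hrn⟩ := ih (by omega)
    have hWfin := M.set_finite W hWE
    obtain ⟨e, heE, heW⟩ : ∃ e ∈ M.E, e ∉ W := by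
      by_contra! h
      have := ncard_le_ncard (show M.E ⊆ W from h) hWfin
      omega
    obtain ⟨C, hC, heC, hCk⟩ := hcov e heE
    have hCfin := M.set_finite C hC.subset_ground
    have hcard : (W ∪ C).ncard = W.ncard + (C \ W).ncard := by
      rw [← union_sdiff_self, ncard_union_eq disjoint_sdiff_right hWfin hCfin.sdiff]
    have hd : ((C \ W) \ {e}).ncard + 1 = (C \ W).ncard :=
      ncard_sdiff_singleton_add_one ⟨heC, heW⟩ hCfin.sdiff
    have hle : (C \ W).ncard ≤ C.ncard := ncard_le_ncard sdiff_subset hCfin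
    refine ⟨W ∪ C, hYW.trans subset_union_left, union_subset hWE hC.subset_ground, by omega,
      r + ((C \ W) \ {e}).ncard, ?_, by omega⟩
    have hcl : W ∪ C ⊆ M.closure (W ∪ ((C \ W) \ {e})) := by
      have hsub : C \ {e} ⊆ W ∪ ((C \ W) \ {e}) := by
        intro x hx
        by_cases hxW : x ∈ W
        · exact Or.inl hxW
        · exact Or.inr ⟨⟨hx.1, hxW⟩, hx.2⟩
      refine union_subset (M.subset_closure_of_subset' subset_union_left hWE) ?_
      have := hC.subset_closure_sdiff_singleton e
      exact this.trans (M.closure_subset_closure hsub)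
    calc M.eRk (W ∪ C) ≤ M.eRk (W ∪ ((C \ W) \ {e})) := by
          rw [← M.eRk_closure_eq (W ∪ ((C \ W) \ {e}))]; exact M.eRk_mono hcl
      _ ≤ M.eRk W + ((C \ W) \ {e}).encard := M.eRk_union_le_eRk_add_encard _ _
      _ ≤ r + ((C \ W) \ {e}).encard := by gcongr
      _ = _ := by rw [← hCfin.sdiff.sdiff.cast_ncard_eq]; norm_cast

/-- With nullity at least `|Y| + 1`, the set `W` stays dependent after `Y` is deleted. -/
lemma exists_isCircuit_disjoint [M.Finite] {k : ℕ} (hk : 1 ≤ k)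
    (hcov : ∀ e ∈ M.E, ∃ C, M.IsCircuit C ∧ e ∈ C ∧ C.ncard ≤ k) {Y : Set α} (hY : Y ⊆ M.E)
    (hE : Y.ncard + k * (Y.ncard + 1) ≤ M.E.ncard) :
    ∃ C, M.IsCircuit C ∧ Disjoint Y C ∧ C.ncard ≤ k * (Y.ncard + 1) := by
  obtain ⟨W, hYW, hWE, hWc, r, hr, hrn⟩ := exists_superset_eRk_add_le hk hcov hY _ hE
  have hWfin := M.set_finite W hWE
  have hcard : (W \ Y).ncard + Y.ncard = W.ncard := ncard_sdiff_add_ncard_of_subset hYW hWfin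
  have hdep : M.Dep (W \ Y) := by
    rw [← M.not_indep_iff (sdiff_subset.trans hWE)]
    intro hi
    have := (hi.encard_le_eRk_of_subset sdiff_subset).trans hr
    rw [← hWfin.sdiff.cast_ncard_eq] at this
    norm_cast at this
    omega
  obtain ⟨C, hCss, hC⟩ := hdep.exists_isCircuit_subset
  have := ncard_le_ncard hCss hWfin.sdiff
  exact ⟨C, hC, (disjoint_sdiff_left.mono_left hCss).symm, by omega⟩

/-- A bound for the number of elements in the first `n` members of a greedily chosen sequence of
disjoint circuits, when every element is in a circuit of size at most `k`. -/
def greedyBound (k : ℕ) : ℕ → ℕ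
  | 0 => 0
  | n + 1 => greedyBound k n + k * (greedyBound k n + 1)

lemma greedyBound_mono (k : ℕ) : Monotone (greedyBound k) :=
  monotone_nat_of_le_succ fun n => by simp [greedyBound]

lemma exists_disjoint_isCircuit_seq [M.Finite] {k : ℕ} (hk : 1 ≤ k)
    (hcov : ∀ e ∈ M.E, ∃ C, M.IsCircuit C ∧ e ∈ C ∧ C.ncard ≤ k) {d : ℕ}
    (hE : greedyBound k d ≤ M.E.ncard) :
    ∃ C : ℕ → Set α, (∀ i < d, M.IsCircuit (C i)) ∧ (∀ i j, i < j → j < d → Disjoint (C i) (C j)) ∧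
      ∀ j ≤ d, (⋃ i ∈ Finset.range j, C i).ncard ≤ greedyBound k j := by
  have h : ∀ Y : Set α, Y ⊆ M.E ∧ Y.ncard + k * (Y.ncard + 1) ≤ M.E.ncard →
      ∃ C, M.IsCircuit C ∧ Disjoint Y C ∧ C.ncard ≤ k * (Y.ncard + 1) :=
    fun Y hY => exists_isCircuit_disjoint hk hcov hY.1 hY.2
  choose! pick hpick using h
  let Y : ℕ → Set α := fun n => Nat.rec ∅ (fun _ Z => Z ∪ pick Z) n
  have hYs : ∀ n, Y (n + 1) = Y n ∪ pick (Y n) := fun n => rfl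
  have hbound : ∀ n Z, Z ⊆ M.E → n < d → Z.ncard ≤ greedyBound k n →
      Z ⊆ M.E ∧ Z.ncard + k * (Z.ncard + 1) ≤ M.E.ncard := by
    intro n Z hZ hn hc
    refine ⟨hZ, le_trans ?_ ((greedyBound_mono k (Nat.succ_le_of_lt hn)).trans hE)⟩
    simp only [greedyBound]
    gcongr
  have hY : ∀ n ≤ d, Y n ⊆ M.E ∧ (Y n).ncard ≤ greedyBound k n := by
    intro n
    induction n with
    | zero => intro _; simp [Y, greedyBound]
    | succ n ih =>
      intro hn
      obtain ⟨h1, h2⟩ := ih (by omega)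
      obtain ⟨hC, -, hc⟩ := hpick _ (hbound n _ h1 hn h2)
      rw [hYs]
      refine ⟨union_subset h1 hC.subset_ground, (ncard_union_le _ _).trans ?_⟩
      simp only [greedyBound]
      refine add_le_add h2 (hc.trans ?_)
      gcongr
  have hYU : ∀ n, Y n = ⋃ i ∈ Finset.range n, pick (Y i) := by
    intro n
    induction n with
    | zero => simp [Y]
    | succ n ih =>
      rw [hYs, Finset.range_add_one, Finset.set_biUnion_insert, ← ih, union_comm]
  refine ⟨fun i => pick (Y i), fun i hi => ?_, fun i j hij hj => ?_, fun j hj => ?_⟩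
  · exact (hpick _ (hbound i _ (hY i hi.le).1 hi (hY i hi.le).2)).1
  · refine (hpick _ (hbound j _ (hY j hj.le).1 hj (hY j hj.le).2)).2.1.mono_left ?_
    rw [hYU j]
    exact subset_biUnion_of_mem (u := fun i => pick (Y i)) (Finset.mem_coe.2 (Finset.mem_range.2 hij))
  · rw [← hYU j]
    exact (hY j hj).2

end Matroid

/-! ### From circuits sharing a common part to circuits made of pairs. -/

namespace Matroid

variable {α ι : Type*} {M : Matroid α} {C : ι → Set α} {c x : ι → α} {P : Set α} {J : Finset ι}

lemma IsCircuit.pair_subset_of_subset_biUnion (hC : ∀ j ∈ J, M.IsCocircuit (C j))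
    (hdisj : (J : Set ι).PairwiseDisjoint C) (hc : ∀ j ∈ J, c j ∈ C j) (hx : ∀ j ∈ J, x j ∈ C j)
    {D : Set α} (hD : M.IsCircuit D) (hDJ : D ⊆ ⋃ j ∈ J, {c j, x j}) {j : ι} (hj : j ∈ J)
    (h : c j ∈ D ∨ x j ∈ D) : c j ∈ D ∧ x j ∈ D := by
  have hne : (D ∩ C j).Nonempty := h.elim (fun h => ⟨_, h, hc j hj⟩) (fun h => ⟨_, h, hx j hj⟩)
  have hnt := hD.isCocircuit_inter_nontrivial (hC j hj) hne
  have hsub : ∀ y ∈ D ∩ C j, y = c j ∨ y = x j := by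
    rintro y ⟨hyD, hyC⟩
    obtain ⟨i, hi, hyi⟩ := mem_iUnion₂.1 (hDJ hyD)
    have hyCi : y ∈ C i := by
      rcases hyi with rfl | rfl
      exacts [hc i hi, hx i hi]
    obtain rfl : i = j := hdisj.elim_set hi hj y hyCi hyC
    simpa using hyi
  obtain ⟨y, hy, z, hz, hyz⟩ := hnt
  rcases hsub y hy with rfl | rfl <;> rcases hsub z hz with rfl | rfl
  · exact absurd rfl hyz
  · exact ⟨hy.1, hz.1⟩
  · exact ⟨hz.1, hy.1⟩
  · exact absurd rfl hyz

/-- Extend the independent set of all `x j` to a basis `I` of the union of the pairs. Since `P` and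
the `x j` span everything, `I` contains at most `|P|` of the `c j`; these indices form `K`. For any
other `j`, the fundamental circuit of `c j` is a union of pairs, and each pair other than the `j`th
has its `c i` in `I`. -/
lemma exists_small_subset_forall_isCircuit (hC : ∀ j ∈ J, M.IsCocircuit (C j))
    (hdisj : (J : Set ι).PairwiseDisjoint C) (hc : ∀ j ∈ J, c j ∈ C j) (hx : ∀ j ∈ J, x j ∈ C j)
    (hcx : ∀ j ∈ J, c j ≠ x j) (hP : P.Finite)
    (hPJ : ∀ j ∈ J, M.IsCircuit (P ∪ {c j, x j})) {A : Finset ι} (hA : A ⊆ J) :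
    ∃ K ⊆ A, K.card ≤ P.ncard ∧ ∀ j ∈ A, j ∉ K → ∃ D, M.IsCircuit D ∧ c j ∈ D ∧ x j ∈ D ∧
      D ⊆ {c j, x j} ∪ ⋃ i ∈ K, {c i, x i} := by
  classical
  have hinj : ∀ i ∈ J, ∀ j ∈ J, ∀ y, y ∈ C i → y ∈ C j → i = j :=
    fun i hi j hj y h h' => hdisj.elim_set hi hj y h h'
  have hcE : ∀ j ∈ J, c j ∈ M.E := fun j hj => (hPJ j hj).subset_ground (by simp)
  have hxE : ∀ j ∈ J, x j ∈ M.E := fun j hj => (hPJ j hj).subset_ground (by simp)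
  have hX : M.Indep (x '' A) := by
    rw [indep_iff_forall_subset_not_isCircuit (by rintro _ ⟨j, hj, rfl⟩; exact hxE j (hA hj))]
    intro D hDX hD
    obtain ⟨y, hy⟩ := hD.nonempty
    obtain ⟨j, hj, rfl⟩ := hDX hy
    have hDJ : D ⊆ ⋃ j ∈ J, {c j, x j} := by
      intro y hy
      obtain ⟨i, hi, rfl⟩ := hDX hy
      exact mem_iUnion₂.2 ⟨i, hA hi, by simp⟩
    have h := (hD.pair_subset_of_subset_biUnion hC hdisj hc hx hDJ (hA hj) (Or.inr hy)).1
    obtain ⟨i, hi, hic⟩ := hDX h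
    obtain rfl := hinj i (hA hi) j (hA hj) (c j) (hic ▸ hx i (hA hi)) (hc j (hA hj))
    exact hcx i (hA hi) hic.symm
  have hcXE : x '' A ∪ c '' A ⊆ M.E := by
    rintro _ (⟨j, hj, rfl⟩ | ⟨j, hj, rfl⟩)
    exacts [hxE j (hA hj), hcE j (hA hj)]
  obtain ⟨I, hI, hXI⟩ := hX.subset_isBasis_of_subset (subset_union_left (t := c '' A)) hcXE
  refine ⟨A.filter (fun j => c j ∈ I), Finset.filter_subset _ _, ?_, ?_⟩
  · have hinjc : InjOn c A := fun i hi j hj h =>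
      hinj i (hA hi) j (hA hj) (c i) (hc i (hA hi)) (h ▸ hc j (hA hj))
    have hinjx : InjOn x A := fun i hi j hj h =>
      hinj i (hA hi) j (hA hj) (x i) (hx i (hA hi)) (h ▸ hx j (hA hj))
    set K := A.filter (fun j => c j ∈ I) with hK
    have hKA : (K : Set ι) ⊆ A := Finset.coe_subset.2 (Finset.filter_subset _ _)
    have hsub : x '' A ∪ c '' K ⊆ I := by
      refine union_subset hXI ?_
      rintro _ ⟨j, hj, rfl⟩
      exact (Finset.mem_filter.1 hj).2
    have hd : Disjoint (x '' A) (c '' K) := by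
      rw [Set.disjoint_left]
      rintro _ ⟨i, hi, rfl⟩ ⟨j, hj, hij⟩
      obtain rfl := hinj i (hA hi) j (hA (hKA hj)) (x i) (hx i (hA hi))
        (hij ▸ hc j (hA (hKA hj)))
      exact hcx i (hA hi) hij
    have hcl : I ⊆ M.closure (P ∪ x '' A) := by
      refine hI.subset.trans (union_subset ?_ ?_)
      · exact M.subset_closure_of_subset' subset_union_right hX.subset_ground
      · rintro _ ⟨j, hj, rfl⟩
        have h := (hPJ j (hA hj)).mem_closure_sdiff_singleton_of_mem (e := c j) (by simp)
        refine M.closure_subset_closure ?_ h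
        rintro y ⟨hy | hy | hy, hyc⟩
        · exact Or.inl hy
        · exact absurd hy hyc
        · rw [mem_singleton_iff.1 hy]; exact Or.inr ⟨j, hj, rfl⟩
    have hle : (x '' A ∪ c '' K).encard ≤ (P ∪ x '' A).encard := by
      calc _ ≤ I.encard := encard_le_encard hsub
        _ ≤ M.eRk (M.closure (P ∪ x '' A)) := hI.indep.encard_le_eRk_of_subset hcl
        _ = M.eRk (P ∪ x '' A) := M.eRk_closure_eq _
        _ ≤ _ := M.eRk_le_encard _
    have hle := hle.trans (encard_union_le _ _)
    rw [encard_union_eq hd, hinjx.encard_image, (hinjc.mono hKA).encard_image,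
      ← hP.cast_ncard_eq, encard_coe_eq_coe_finsetCard, encard_coe_eq_coe_finsetCard] at hle
    norm_cast at hle
    omega
  · intro j hj hjK
    have hcI : c j ∉ I := fun h => hjK (Finset.mem_filter.2 ⟨hj, h⟩)
    have hcl : c j ∈ M.closure I := hI.subset_closure (Or.inr ⟨j, hj, rfl⟩)
    obtain ⟨D, hDI, hD, hcD⟩ := exists_isCircuit_of_mem_closure hcl hcI
    have hDA : ∀ y ∈ D, ∃ i ∈ A, y = c i ∨ y = x i := by
      intro y hy
      rcases hDI hy with rfl | hyI
      · exact ⟨j, hj, Or.inl rfl⟩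
      · rcases hI.subset hyI with ⟨i, hi, rfl⟩ | ⟨i, hi, rfl⟩
        exacts [⟨i, hi, Or.inr rfl⟩, ⟨i, hi, Or.inl rfl⟩]
    have hDJ : D ⊆ ⋃ j ∈ J, {c j, x j} := by
      intro y hy
      obtain ⟨i, hi, hyi⟩ := hDA y hy
      exact mem_iUnion₂.2 ⟨i, hA hi, hyi⟩
    have hpair : ∀ i ∈ A, c i ∈ D ∨ x i ∈ D → c i ∈ D ∧ x i ∈ D := fun i hi =>
      hD.pair_subset_of_subset_biUnion hC hdisj hc hx hDJ (hA hi)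
    refine ⟨D, hD, hcD, (hpair j hj (Or.inl hcD)).2, fun y hy => ?_⟩
    obtain ⟨i, hi, hyi⟩ := hDA y hy
    have hci : c i ∈ D := (hpair i hi (by rcases hyi with rfl | rfl <;> simp [hy])).1
    rcases hDI hci with hcc | hcI'
    · obtain rfl := hinj i (hA hi) j (hA hj) (c i) (hc i (hA hi)) (hcc ▸ hc j (hA hj))
      exact Or.inl hyi
    · exact Or.inr (mem_iUnion₂.2 ⟨i, Finset.mem_filter.2 ⟨hi, hcI'⟩, hyi⟩)

/-- Peeling off `n` disjoint exceptional sets `K` leaves `n` disjoint places to route `D`; a set `W`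
with fewer than `n` elements cannot block them all. -/
lemma exists_subset_forall_isCircuit_avoiding (hC : ∀ j ∈ J, M.IsCocircuit (C j))
    (hdisj : (J : Set ι).PairwiseDisjoint C) (hc : ∀ j ∈ J, c j ∈ C j) (hx : ∀ j ∈ J, x j ∈ C j)
    (hcx : ∀ j ∈ J, c j ≠ x j) (hP : P.Finite)
    (hPJ : ∀ j ∈ J, M.IsCircuit (P ∪ {c j, x j})) (n : ℕ) {A : Finset ι} (hA : A ⊆ J) :
    ∃ U ⊆ A, U.card ≤ n * P.ncard ∧ ∀ j ∈ A, j ∉ U → ∀ W : Set α, W.Finite → W.ncard < n →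
      ∃ D, M.IsCircuit D ∧ c j ∈ D ∧ x j ∈ D ∧ D ∩ W ⊆ {c j, x j} ∧ D ⊆ ⋃ i ∈ A, {c i, x i} := by
  classical
  induction n generalizing A with
  | zero => exact ⟨∅, by simp, by simp, by simp⟩
  | succ n ih =>
    obtain ⟨K, hKA, hKc, hK⟩ := exists_small_subset_forall_isCircuit hC hdisj hc hx hcx hP hPJ hA
    obtain ⟨U, hUA, hUc, hU⟩ := ih (A := A \ K) (Finset.sdiff_subset.trans hA)
    refine ⟨K ∪ U, Finset.union_subset hKA (hUA.trans Finset.sdiff_subset), ?_, ?_⟩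
    · have := Finset.card_union_le K U
      rw [add_mul, one_mul]
      omega
    · intro j hj hjU W hW hWn
      rw [Finset.mem_union, not_or] at hjU
      by_cases hWK : Disjoint W (⋃ i ∈ K, {c i, x i})
      · obtain ⟨D, hD, hcD, hxD, hDK⟩ := hK j hj hjU.1
        refine ⟨D, hD, hcD, hxD, fun y hy => ?_, fun y hy => ?_⟩
        · exact (hDK hy.1).resolve_right (disjoint_left.1 hWK hy.2)
        · rcases hDK hy with h | h
          · exact mem_iUnion₂.2 ⟨j, hj, h⟩
          · obtain ⟨i, hi, hyi⟩ := mem_iUnion₂.1 h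
            exact mem_iUnion₂.2 ⟨i, hKA hi, hyi⟩
      -- Here `W` spends an element on the pairs of `K`. The circuit found in `A \ K` avoids those
      -- pairs, so only the smaller remainder of `W` matters.
      · obtain ⟨w, hwW, hwK⟩ := not_disjoint_iff.1 hWK
        have hlt : (W \ ⋃ i ∈ K, {c i, x i}).ncard < W.ncard :=
          ncard_lt_ncard (sdiff_ssubset_left_iff.2 ⟨w, hwW, hwK⟩) hW
        obtain ⟨D, hD, hcD, hxD, hDW, hDA⟩ := hU j (Finset.mem_sdiff.2 ⟨hj, hjU.1⟩) hjU.2 _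
          (hW.sdiff (t := ⋃ i ∈ K, {c i, x i})) (by omega)
        refine ⟨D, hD, hcD, hxD, fun y hy => hDW ⟨hy.1, hy.2, fun hyK => ?_⟩, fun y hy => ?_⟩
        · obtain ⟨i, hi, hyi⟩ := mem_iUnion₂.1 hyK
          obtain ⟨l, hl, hyl⟩ := mem_iUnion₂.1 (hDA hy.1)
          have hmem : ∀ i ∈ J, y ∈ ({c i, x i} : Set α) → y ∈ C i := by
            rintro i hi (rfl | rfl)
            exacts [hc i hi, hx i hi]
          obtain ⟨hlA, hlK⟩ := Finset.mem_sdiff.1 hl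
          obtain rfl : i = l := hdisj.elim_set (hA (hKA hi)) (hA hlA) y
            (hmem i (hA (hKA hi)) hyi) (hmem l (hA hlA) hyl)
          exact hlK hi
        · obtain ⟨i, hi, hyi⟩ := mem_iUnion₂.1 (hDA hy)
          exact mem_iUnion₂.2 ⟨i, (Finset.mem_sdiff.1 hi).1, hyi⟩

end Matroid

/-! ### Circuit-linked pairs. -/

namespace Matroid

lemma two_mul_card_le_ncard_inter_biUnion {α ι : Type*} {C : ι → Set α} {I : Finset ι}
    (hdisj : (I : Set ι).PairwiseDisjoint C) {D : Set α} (hD : D.Finite)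
    (h : ∀ i ∈ I, (D ∩ C i).Nontrivial) : 2 * I.card ≤ (D ∩ ⋃ i ∈ I, C i).ncard := by
  classical
  induction I using Finset.induction_on with
  | empty => simp
  | insert a I ha ih =>
    have ih := ih (hdisj.subset (by simp)) fun i hi => h i (Finset.mem_insert_of_mem hi)
    have h2 : 1 < (D ∩ C a).ncard :=
      one_lt_ncard_iff_nontrivial_and_finite.2
      ⟨h a (Finset.mem_insert_self _ _), hD.inter_of_left _⟩
    have hd : Disjoint (D ∩ C a) (D ∩ ⋃ i ∈ I, C i) := by
      refine Disjoint.mono inter_subset_right inter_subset_right ?_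
      rw [disjoint_iUnion₂_right]
      intro i hi
      exact hdisj (by simp) (by simp [hi]) (by rintro rfl; exact ha hi)
    rw [Finset.set_biUnion_insert, inter_union_distrib_left,
      ncard_union_eq hd (hD.inter_of_left _) (hD.inter_of_left _), Finset.card_insert_of_notMem ha]
    omega

variable {α : Type*} {M : Matroid α}

lemma exists_common_part_of_cocircuits [M.Finite] {t m d : ℕ} (ht : 1 ≤ t) (hm : 1 ≤ m)
    (hK : ∀ X ⊆ M.E, X.encard = t → ∃ K, M.IsCocircuit K ∧ K.encard = (2 * t : ℕ) ∧ X ⊆ K)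
    {C : ℕ → Set α} (hC : ∀ i < d, M.IsCircuit (C i))
    (hdisj : ∀ i j, i < j → j < d → Disjoint (C i) (C j)) {z : ℕ}
    (hz : (⋃ i ∈ Finset.range (t - 1), C i).ncard ≤ z) (hd : (t - 1) + 2 ^ z * m ≤ d) :
    ∃ (P : Set α) (J : Finset ℕ) (c x : ℕ → α), P.Finite ∧ P.ncard ≤ 2 * t ∧ (∀ j ∈ J, j < d) ∧
      m ≤ J.card ∧ (∀ j ∈ J, c j ∈ C j) ∧ (∀ j ∈ J, x j ∈ C j) ∧ (∀ j ∈ J, c j ≠ x j) ∧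
      ∀ j ∈ J, M.IsCocircuit (P ∪ {c j, x j}) := by
  classical
  have hdisj' : ((Finset.range d : Finset ℕ) : Set ℕ).PairwiseDisjoint C := by
    intro i hi j hj hij
    simp only [Finset.coe_range, mem_Iio] at hi hj
    rcases lt_or_gt_of_ne hij with h | h
    exacts [hdisj i j h hj, (hdisj j i h hi).symm]
  set Z := ⋃ i ∈ Finset.range (t - 1), C i with hZ
  have hZfin : Z.Finite := (Finset.range (t - 1)).finite_toSet.biUnion fun i hi =>
    M.set_finite _ (hC i (by have := Finset.mem_range.1 (Finset.mem_coe.1 hi); omega)).subset_ground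
  have hd0 : 0 < d := by
    have : 1 ≤ 2 ^ z * m := Nat.mul_pos (by positivity) hm
    omega
  have : Nonempty α := ⟨(hC 0 hd0).nonempty.some⟩
  choose! c hc using fun i (hi : i < d) => (hC i hi).nonempty
  have key : ∀ j, t - 1 ≤ j → j < d →
      ∃ D y, M.IsCocircuit D ∧ D.encard = (2 * t : ℕ) ∧ y ∈ C j ∧ c j ≠ y ∧ D \ Z = {c j, y} := by
    intro j htj hjd
    have hX : (c '' ((insert j (Finset.range (t - 1)) : Finset ℕ) : Set ℕ)).encard = t := by
      rw [InjOn.encard_image, encard_coe_eq_coe_finsetCard, Finset.card_insert_of_notMem (by simp [htj]),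
        Finset.card_range, Nat.sub_add_cancel ht]
      intro a ha b hb hab
      simp only [Finset.coe_insert, Finset.coe_range, mem_insert_iff, mem_Iio] at ha hb
      have ha' : a < d := by omega
      have hb' : b < d := by omega
      exact hdisj'.elim_set (by simpa using ha') (by simpa using hb') (c a) (hc a ha')
        (hab ▸ hc b hb')
    have hlt : ∀ i ∈ insert j (Finset.range (t - 1)), i < d := by
      intro i hi
      simp only [Finset.mem_insert, Finset.mem_range] at hi
      omega
    obtain ⟨D, hD, hDc, hXD⟩ := hK _ (by
      rintro _ ⟨i, hi, rfl⟩
      exact (hC i (hlt i hi)).subset_ground (hc i (hlt i hi))) hX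
    have hDfin : D.Finite := M.set_finite D hD.subset_ground
    have hnt : ∀ i ∈ insert j (Finset.range (t - 1)), (D ∩ C i).Nontrivial := by
      intro i hi
      rw [inter_comm]
      exact (hC i (hlt i hi)).isCocircuit_inter_nontrivial hD
        ⟨c i, hc i (hlt i hi), hXD ⟨i, hi, rfl⟩⟩
    have hDZ := two_mul_card_le_ncard_inter_biUnion (I := Finset.range (t - 1)) (C := C)
      (hdisj'.subset (by
        intro i hi
        simpa using hlt i (Finset.mem_insert_of_mem hi))) hDfin
      fun i hi => hnt i (Finset.mem_insert_of_mem hi)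
    rw [← hZ, Finset.card_range] at hDZ
    have hsum := ncard_inter_add_ncard_sdiff_eq_ncard D Z hDfin
    rw [← hDfin.cast_ncard_eq] at hDc
    norm_cast at hDc
    have hCZ : D ∩ C j ⊆ D \ Z := by
      rintro y ⟨hyD, hyC⟩
      refine ⟨hyD, fun hyZ => ?_⟩
      obtain ⟨i, hi, hyi⟩ := mem_iUnion₂.1 hyZ
      rw [Finset.mem_range] at hi
      exact disjoint_left.1 (hdisj i j (by omega) hjd) hyi hyC
    have h2 : 1 < (D ∩ C j).ncard :=
      one_lt_ncard_iff_nontrivial_and_finite.2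
      ⟨hnt j (Finset.mem_insert_self _ _), hDfin.inter_of_left _⟩
    -- At least `2(t - 1)` of the `2t` elements of `D` lie in `Z`, so at most two lie outside it.
    have heq : D ∩ C j = D \ Z := eq_of_subset_of_ncard_le hCZ (by omega) hDfin.sdiff
    have hcD : c j ∈ D ∩ C j := ⟨hXD ⟨j, by simp, rfl⟩, hc j hjd⟩
    obtain ⟨y, hy, hyc⟩ := (one_lt_ncard_iff_nontrivial_and_finite.1 h2).1.exists_ne (c j)
    refine ⟨D, y, hD, ?_, hy.2, hyc.symm, ?_⟩
    · rw [← hDfin.cast_ncard_eq, hDc]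
    · rw [← heq]
      refine (eq_of_subset_of_ncard_le (pair_subset hcD hy) ?_ (hDfin.inter_of_left _)).symm
      rw [ncard_pair hyc.symm, heq]
      omega
  choose! D x hD hDc hxC hcx hDZ using key
  -- Pigeonhole over the at most `2 ^ z` subsets of `Z`.
  obtain ⟨P, hP, hPm⟩ := Finset.exists_le_card_fiber_of_mul_le_card_of_maps_to
    (s := Finset.Ico (t - 1) d) (t := hZfin.powerset.toFinset) (f := fun j => D j ∩ Z) (n := m)
    (fun j _ => by simp) ⟨∅, by simp⟩ (by
      rw [← ncard_eq_toFinset_card _ hZfin.powerset, ncard_powerset Z hZfin, Nat.card_Ico]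
      have : 2 ^ Z.ncard * m ≤ 2 ^ z * m := by gcongr; norm_num
      omega)
  have hJ : ∀ j ∈ (Finset.Ico (t - 1) d).filter (fun j => D j ∩ Z = P),
      (t - 1 ≤ j ∧ j < d) ∧ D j ∩ Z = P := by
    intro j hj
    simpa using hj
  have hPsub : P ⊆ Z := by simpa using hP
  obtain ⟨j₀, hj₀⟩ := Finset.card_pos.1 (Nat.lt_of_lt_of_le hm hPm)
  refine ⟨P, (Finset.Ico (t - 1) d).filter (fun j => D j ∩ Z = P), c, x, hZfin.subset hPsub, ?_,
    fun j hj => (hJ j hj).1.2, hPm, fun j hj => hc j (hJ j hj).1.2,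
    fun j hj => hxC j (hJ j hj).1.1 (hJ j hj).1.2, fun j hj => hcx j (hJ j hj).1.1 (hJ j hj).1.2,
    fun j hj => ?_⟩
  · obtain ⟨⟨h1, h2⟩, h3⟩ := hJ j₀ hj₀
    have hDfin : (D j₀).Finite := M.set_finite _ (hD j₀ h1 h2).subset_ground
    have h4 := hDc j₀ h1 h2
    rw [← hDfin.cast_ncard_eq] at h4
    norm_cast at h4
    rw [← h3, ← h4]
    exact ncard_le_ncard inter_subset_left hDfin
  · obtain ⟨⟨h1, h2⟩, h3⟩ := hJ j hj
    rw [← h3, ← hDZ j h1 h2, inter_union_sdiff]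
    exact hD j h1 h2

/-- Every `k`-element circuit that meets `p` contains `p`. -/
def IsCircuitLinked (M : Matroid α) (k : ℕ) (p : Set α) : Prop :=
  ∀ C, M.IsCircuit C → C.encard = k → (C ∩ p).Nonempty → p ⊆ C

lemma le_greedyBound {k : ℕ} (hk : 1 ≤ k) (n : ℕ) : n ≤ greedyBound k n := by
  induction n with
  | zero => simp
  | succ n ih =>
    have := Nat.mul_le_mul hk (Nat.succ_le_succ ih)
    simp only [greedyBound, Nat.succ_eq_add_one] at *
    omega

/-- A ground set size that forces `m` disjoint circuit-linked pairs. -/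
def linkedPairsBound (t m : ℕ) : ℕ :=
  greedyBound (2 * t)
    ((t - 1) + 2 ^ greedyBound (2 * t) (t - 1) * (m + (2 * t + 1) * (2 * t)))

lemma exists_linked_pairs [M.Finite] {t m : ℕ} (ht : 1 ≤ t)
    (hC : ∀ X ⊆ M.E, X.encard = t → ∃ C, M.IsCircuit C ∧ C.encard = (2 * t : ℕ) ∧ X ⊆ C)
    (hK : ∀ X ⊆ M.E, X.encard = t → ∃ K, M.IsCocircuit K ∧ K.encard = (2 * t : ℕ) ∧ X ⊆ K)
    (hE : linkedPairsBound t m ≤ M.E.ncard) :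
    ∃ 𝓕 : Finset (Set α), m ≤ 𝓕.card ∧ (𝓕 : Set (Set α)).PairwiseDisjoint id ∧
      (∀ p ∈ 𝓕, p ⊆ M.E) ∧ (∀ p ∈ 𝓕, p.encard = 2) ∧
      ∀ p ∈ 𝓕, M.IsCircuitLinked (2 * t) p := by
  classical
  set z := greedyBound (2 * t) (t - 1) with hz
  set m' := m + (2 * t + 1) * (2 * t) with hm'
  have hm'1 : 1 ≤ m' := by nlinarith
  have hd1 : t ≤ (t - 1) + 2 ^ z * m' := by
    have : 1 ≤ 2 ^ z * m' := Nat.mul_pos (by positivity) hm'1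
    omega
  have htE : t ≤ M.E.ncard := (hd1.trans (le_greedyBound (by omega) _)).trans hE
  have hcov : ∀ e ∈ M.E, ∃ C, M.IsCircuit C ∧ e ∈ C ∧ C.ncard ≤ 2 * t := by
    intro e he
    obtain ⟨X, heX, hXE, hX⟩ := exists_superset_subset_encard_eq (k := t)
      (singleton_subset_iff.2 he) (by simpa using ht)
      (by rw [← M.ground_finite.cast_ncard_eq]; exact_mod_cast htE)
    obtain ⟨C, hC, hCc, hXC⟩ := hC X hXE hX
    refine ⟨C, hC, hXC (heX rfl), ?_⟩
    rw [← (M.set_finite C hC.subset_ground).cast_ncard_eq] at hCc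
    exact_mod_cast hCc.le
  obtain ⟨C, hCc, hdisj, hb⟩ := exists_disjoint_isCircuit_seq (by omega) hcov hE
  obtain ⟨P, J, c, x, hP, hPt, hJd, hJm, hc, hx, hcx, hPJ⟩ :=
    exists_common_part_of_cocircuits (z := z) (m := m') ht hm'1 hK hCc hdisj (hb (t - 1) (by omega)) le_rfl
  have hdJ : (J : Set ℕ).PairwiseDisjoint C := by
    intro i hi j hj hij
    rcases lt_or_gt_of_ne hij with h | h
    exacts [hdisj i j h (hJd j hj), (hdisj j i h (hJd i hi)).symm]
  -- In the dual the `C j` are cocircuits and the sets `P ∪ {c j, x j}` are circuits. The value `2 *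
  -- t + 1` lets the set to be avoided be any `2t`-element circuit `B`.
  obtain ⟨U, hUJ, hUc, hU⟩ := exists_subset_forall_isCircuit_avoiding (M := M✶)
    (fun j hj => (hCc j (hJd j hj)).isCocircuit) hdJ hc hx hcx hP hPJ (2 * t + 1) Finset.Subset.rfl
  have hmem : ∀ j ∈ J, ({c j, x j} : Set α) ⊆ C j := fun j hj => pair_subset (hc j hj) (hx j hj)
  refine ⟨(J \ U).image fun j => {c j, x j}, ?_, ?_, ?_, ?_, ?_⟩
  · rw [Finset.card_image_of_injOn, Finset.card_sdiff_of_subset hUJ]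
    · have := Nat.mul_le_mul_left (2 * t + 1) hPt
      omega
    · intro i hi j hj hij
      have hi' := (Finset.mem_sdiff.1 hi).1
      have hj' := (Finset.mem_sdiff.1 hj).1
      refine hdJ.elim_set hi' hj' (c i) (hc i hi') (hmem j hj' ?_)
      rw [← show ({c i, x i} : Set α) = {c j, x j} from hij]
      simp
  · intro p hp q hq hpq
    obtain ⟨i, hi, rfl⟩ := Finset.mem_image.1 (Finset.mem_coe.1 hp)
    obtain ⟨j, hj, rfl⟩ := Finset.mem_image.1 (Finset.mem_coe.1 hq)
    have hi' := (Finset.mem_sdiff.1 hi).1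
    have hj' := (Finset.mem_sdiff.1 hj).1
    exact (hdJ hi' hj' (by rintro rfl; exact hpq rfl)).mono (hmem i hi') (hmem j hj')
  · intro p hp
    obtain ⟨j, hj, rfl⟩ := Finset.mem_image.1 hp
    exact subset_union_right.trans (hPJ j (Finset.mem_sdiff.1 hj).1).subset_ground
  · intro p hp
    obtain ⟨j, hj, rfl⟩ := Finset.mem_image.1 hp
    exact encard_pair (hcx j (Finset.mem_sdiff.1 hj).1)
  · intro p hp B hB hBc hBp
    obtain ⟨j, hj, rfl⟩ := Finset.mem_image.1 hp
    obtain ⟨hjJ, hjU⟩ := Finset.mem_sdiff.1 hj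
    have hBfin : B.Finite := M.set_finite B hB.subset_ground
    rw [← hBfin.cast_ncard_eq] at hBc
    norm_cast at hBc
    obtain ⟨D, hD, hcD, hxD, hDB, -⟩ := hU j hjJ hjU B hBfin (by omega)
    have hne : (B ∩ D).Nonempty := by
      obtain ⟨y, hyB, rfl | rfl⟩ := hBp
      exacts [⟨_, hyB, hcD⟩, ⟨_, hyB, hxD⟩]
    obtain ⟨y, hy, w, hw, hyw⟩ := hB.isCocircuit_inter_nontrivial hD hne
    have hy' := hDB ⟨hy.2, hy.1⟩
    have hw' := hDB ⟨hw.2, hw.1⟩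
    simp only [mem_insert_iff, mem_singleton_iff] at hy' hw'
    have hy1 := hy.1
    have hw1 := hw.1
    rcases hy' with rfl | rfl <;> rcases hw' with rfl | rfl
    · exact absurd rfl hyw
    · exact pair_subset hy1 hw1
    · exact pair_subset hw1 hy1
    · exact absurd rfl hyw

end Matroid

/-! ### Families of pairs and their extension to a spike. -/

namespace Matroid

variable {α : Type*} {M : Matroid α} {t : ℕ} {𝓕 𝓖 : Finset (Set α)}

lemma encard_sUnion_of_encard_eq_two (hdisj : (𝓕 : Set (Set α)).PairwiseDisjoint id)
    (h2 : ∀ p ∈ 𝓕, p.encard = 2) : (⋃₀ (𝓕 : Set (Set α))).encard = (2 * 𝓕.card : ℕ) := by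
  classical
  induction 𝓕 using Finset.induction_on with
  | empty => simp
  | insert p 𝓕 hp ih =>
    have hd : Disjoint p (⋃₀ (𝓕 : Set (Set α))) := by
      rw [disjoint_sUnion_right]
      intro q hq
      exact hdisj (by simp) (Finset.mem_coe.2 (Finset.mem_insert_of_mem hq))
        (by rintro rfl; exact hp hq)
    rw [Finset.coe_insert, sUnion_insert, encard_union_eq hd, h2 p (Finset.mem_insert_self _ _),
      ih (hdisj.subset (by simp)) fun q hq => h2 q (Finset.mem_insert_of_mem hq),
      Finset.card_insert_of_notMem hp]
    push_cast
    ring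

open Classical in
lemma card_not_disjoint_le (hdisj : (𝓕 : Set (Set α)).PairwiseDisjoint id) {D : Set α}
    (hD : D.Finite) : (𝓕.filter fun p => ¬ Disjoint p D).card ≤ D.ncard := by
  rw [ncard_eq_toFinset_card D hD]
  by_cases hα : Nonempty α
  swap
  · rw [Finset.filter_eq_empty_iff.2]
    · simp
    · intro p _ h
      obtain ⟨x, -, -⟩ := not_disjoint_iff.1 h
      exact hα ⟨x⟩
  have h : ∀ p ∈ 𝓕.filter (fun p => ¬ Disjoint p D), ∃ x, x ∈ p ∧ x ∈ D := by
    intro p hp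
    exact not_disjoint_iff.1 (Finset.mem_filter.1 hp).2
  choose! x hxp hxD using h
  refine Finset.card_le_card_of_injOn x (fun p hp => hD.mem_toFinset.2 (hxD p hp)) ?_
  intro p hp q hq hpq
  exact hdisj.elim_set (Finset.mem_filter.1 hp).1 (Finset.mem_filter.1 hq).1 (x p) (hxp p hp)
    (hpq ▸ hxp q hq)

lemma exists_subset_card_eq_disjoint (hdisj : (𝓕 : Set (Set α)).PairwiseDisjoint id) {D : Set α}
    (hD : D.Finite) {n : ℕ} (hn : n + D.ncard ≤ 𝓕.card) :
    ∃ 𝓖 ⊆ 𝓕, 𝓖.card = n ∧ ∀ p ∈ 𝓖, Disjoint p D := by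
  classical
  have h1 := card_not_disjoint_le hdisj hD
  have h2 := Finset.card_filter_add_card_filter_not (s := 𝓕) fun p => Disjoint p D
  obtain ⟨𝓖, h𝓖, hc⟩ := Finset.exists_subset_card_eq
    (s := 𝓕.filter fun p => Disjoint p D) (n := n) (by omega)
  exact ⟨𝓖, h𝓖.trans (Finset.filter_subset _ _), hc, fun p hp => (Finset.mem_filter.1 (h𝓖 hp)).2⟩

lemma exists_isCircuit_sUnion_subset
    (hC : ∀ X ⊆ M.E, X.encard = t → ∃ C, M.IsCircuit C ∧ C.encard = (2 * t : ℕ) ∧ X ⊆ C)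
    (hdisj : (𝓖 : Set (Set α)).PairwiseDisjoint id) (hE : ∀ p ∈ 𝓖, p ⊆ M.E)
    (h2 : ∀ p ∈ 𝓖, p.encard = 2) (hl : ∀ p ∈ 𝓖, M.IsCircuitLinked (2 * t) p) {X : Set α}
    (hX : X ⊆ M.E) (hXd : Disjoint X (⋃₀ (𝓖 : Set (Set α)))) (hcard : 𝓖.card + X.encard = t) :
    ∃ C, M.IsCircuit C ∧ C.encard = (2 * t : ℕ) ∧ ⋃₀ (𝓖 : Set (Set α)) ∪ X ⊆ C := by
  classical
  have h : ∀ p : 𝓖, ∃ x, x ∈ p.1 := fun p =>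
    nonempty_of_encard_ne_zero (by rw [h2 p.1 p.2]; simp)
  choose x hx using h
  have hinj : Function.Injective x := fun p q hpq =>
    Subtype.ext (hdisj.elim_set p.2 q.2 (x p) (hx p) (hpq ▸ hx q))
  have hsub : range x ⊆ ⋃₀ (𝓖 : Set (Set α)) := by
    rintro _ ⟨p, rfl⟩
    exact ⟨p.1, p.2, hx p⟩
  have hr : (range x).encard = 𝓖.card := by
    rw [← image_univ, hinj.encard_image, encard_univ]
    simp
  obtain ⟨C, hC, hCc, hXC⟩ := hC (range x ∪ X)
    (union_subset (hsub.trans (sUnion_subset hE)) hX)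
    (by rw [encard_union_eq (hXd.symm.mono_left hsub), hr, hcard])
  refine ⟨C, hC, hCc, union_subset (sUnion_subset fun p hp => ?_) (subset_union_right.trans hXC)⟩
  exact hl p hp C hC hCc ⟨x ⟨p, hp⟩, hXC (Or.inl ⟨_, rfl⟩), hx ⟨p, hp⟩⟩

/-- A `2t`-element circuit through a transversal of the `t` pairs contains every pair, leaving no
room for anything else. -/
lemma isCircuit_sUnion_of_isCircuitLinked
    (hC : ∀ X ⊆ M.E, X.encard = t → ∃ C, M.IsCircuit C ∧ C.encard = (2 * t : ℕ) ∧ X ⊆ C)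
    (hdisj : (𝓖 : Set (Set α)).PairwiseDisjoint id) (hE : ∀ p ∈ 𝓖, p ⊆ M.E)
    (h2 : ∀ p ∈ 𝓖, p.encard = 2) (hl : ∀ p ∈ 𝓖, M.IsCircuitLinked (2 * t) p)
    (hcard : 𝓖.card = t) : M.IsCircuit (⋃₀ (𝓖 : Set (Set α))) := by
  obtain ⟨C, hC, hCc, hsub⟩ := exists_isCircuit_sUnion_subset hC hdisj hE h2 hl (empty_subset _)
    (empty_disjoint _) (by simp [hcard])
  rw [union_empty] at hsub
  have hc := encard_sUnion_of_encard_eq_two hdisj h2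
  rw [hcard] at hc
  have hfin : C.Finite := finite_of_encard_eq_coe hCc
  rwa [hfin.eq_of_subset_of_encard_le' hsub (by rw [hc, hCc])]

/-- Given a `2t`-element cocircuit `D` meeting `p`, choose `t - 1` further pairs missing `D \ p`.
Together with `p` they form a circuit meeting `D` only inside `p`, so orthogonality puts all of `p`
in `D`. The bound `3 * t` leaves room for this choice, as `D \ p` blocks at most `2t - 1` pairs. -/
lemma isCircuitLinked_dual (ht : 1 ≤ t) (hdisj : (𝓕 : Set (Set α)).PairwiseDisjoint id)
    (h2 : ∀ p ∈ 𝓕, p.encard = 2) (hC : ∀ 𝓖 ⊆ 𝓕, 𝓖.card = t → M.IsCircuit (⋃₀ (𝓖 : Set (Set α))))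
    (hcard : 3 * t ≤ 𝓕.card) {p : Set α} (hp : p ∈ 𝓕) : M✶.IsCircuitLinked (2 * t) p := by
  classical
  intro D hD hDc hDp
  have hDfin : D.Finite := finite_of_encard_eq_coe hDc
  rw [← hDfin.cast_ncard_eq] at hDc
  norm_cast at hDc
  have hd' : ((𝓕.erase p : Finset (Set α)) : Set (Set α)).PairwiseDisjoint id :=
    hdisj.subset (by simp)
  have hDp' : (D \ p).ncard < D.ncard := by
    obtain ⟨y, hy⟩ := hDp
    exact ncard_lt_ncard (sdiff_ssubset_left_iff.2 ⟨y, hy⟩) hDfin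
  obtain ⟨𝓖, h𝓖, hGc, hGD⟩ := exists_subset_card_eq_disjoint hd' (hDfin.sdiff (t := p)) (n := t - 1)
    (by rw [Finset.card_erase_of_mem hp]; omega)
  have hpG : p ∉ 𝓖 := fun h => Finset.notMem_erase p 𝓕 (h𝓖 h)
  have hcirc := hC (insert p 𝓖)
    (Finset.insert_subset hp (h𝓖.trans (Finset.erase_subset _ _)))
    (by rw [Finset.card_insert_of_notMem hpG]; omega)
  rw [Finset.coe_insert, sUnion_insert] at hcirc
  obtain ⟨y, hyD, hyp⟩ := hDp
  obtain ⟨u, hu, v, hv, huv⟩ := hcirc.isCocircuit_inter_nontrivial hD ⟨y, Or.inl hyp, hyD⟩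
  have hin : ∀ w ∈ (p ∪ ⋃₀ (𝓖 : Set (Set α))) ∩ D, w ∈ p := by
    rintro w ⟨hw | ⟨q, hq, hwq⟩, hwD⟩
    · exact hw
    · by_contra hwp
      exact disjoint_left.1 (hGD q hq) hwq ⟨hwD, hwp⟩
  have hpfin : p.Finite := finite_of_encard_eq_coe (k := 2) (h2 p hp)
  have : ({u, v} : Set α) = p := hpfin.eq_of_subset_of_encard_le'
    (pair_subset (hin u hu) (hin v hv)) (by rw [h2 p hp, encard_pair huv])
  rw [← this]
  exact pair_subset hu.2 hv.2

/-- A family of disjoint pairs of elements such that the union of any `t` of them is both a circuit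
and a cocircuit. -/
structure IsSpikeFamily (M : Matroid α) (t : ℕ) (𝓕 : Finset (Set α)) : Prop where
  pairwiseDisjoint : (𝓕 : Set (Set α)).PairwiseDisjoint id
  subset_ground : ∀ p ∈ 𝓕, p ⊆ M.E
  encard_eq_two : ∀ p ∈ 𝓕, p.encard = 2
  isCircuit : ∀ 𝓖 ⊆ 𝓕, 𝓖.card = t → M.IsCircuit (⋃₀ (𝓖 : Set (Set α)))
  isCocircuit : ∀ 𝓖 ⊆ 𝓕, 𝓖.card = t → M.IsCocircuit (⋃₀ (𝓖 : Set (Set α)))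

lemma IsSpikeFamily.dual (h : M.IsSpikeFamily t 𝓕) : M✶.IsSpikeFamily t 𝓕 where
  pairwiseDisjoint := h.pairwiseDisjoint
  subset_ground := h.subset_ground
  encard_eq_two := h.encard_eq_two
  isCircuit := h.isCocircuit
  isCocircuit 𝓖 h𝓖 hc := (h.isCircuit 𝓖 h𝓖 hc).isCocircuit

lemma IsSpikeFamily.isCircuitLinked (h : M.IsSpikeFamily t 𝓕) (ht : 1 ≤ t)
    (hcard : 3 * t ≤ 𝓕.card) {p : Set α} (hp : p ∈ 𝓕) : M.IsCircuitLinked (2 * t) p := by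
  have := isCircuitLinked_dual ht h.pairwiseDisjoint h.encard_eq_two h.dual.isCircuit hcard hp
  rwa [dual_dual] at this

lemma IsSpikeFamily.exists_partner (h : M.IsSpikeFamily t 𝓕) (ht : 1 ≤ t)
    (hcard : 3 * t ≤ 𝓕.card)
    (hC : ∀ X ⊆ M.E, X.encard = t → ∃ C, M.IsCircuit C ∧ C.encard = (2 * t : ℕ) ∧ X ⊆ C)
    {z : α} (hzE : z ∈ M.E) (hz : z ∉ ⋃₀ (𝓕 : Set (Set α))) (h𝓖 : 𝓖 ⊆ 𝓕) (hGc : 𝓖.card + 1 = t) :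
    ∃ w, w ≠ z ∧ w ∉ ⋃₀ (𝓕 : Set (Set α)) ∧ M.IsCircuit ({z, w} ∪ ⋃₀ (𝓖 : Set (Set α))) := by
  have hdG : (𝓖 : Set (Set α)).PairwiseDisjoint id := h.pairwiseDisjoint.subset (by simpa using h𝓖)
  have hl : ∀ p ∈ 𝓕, M.IsCircuitLinked (2 * t) p := fun p hp => h.isCircuitLinked ht hcard hp
  have hzG : z ∉ ⋃₀ (𝓖 : Set (Set α)) := fun hh => hz (sUnion_mono (by simpa using h𝓖) hh)
  obtain ⟨C, hC, hCc, hsub⟩ := exists_isCircuit_sUnion_subset hC hdG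
    (fun p hp => h.subset_ground p (h𝓖 hp)) (fun p hp => h.encard_eq_two p (h𝓖 hp))
    (fun p hp => hl p (h𝓖 hp)) (singleton_subset_iff.2 hzE)
    (disjoint_singleton_left.2 hzG) (by rw [encard_singleton]; exact_mod_cast hGc)
  have hc := encard_sUnion_of_encard_eq_two hdG fun p hp => h.encard_eq_two p (h𝓖 hp)
  have hCfin : C.Finite := finite_of_encard_eq_coe hCc
  have hUfin := hCfin.subset hsub
  have hUc : (⋃₀ (𝓖 : Set (Set α)) ∪ {z}).encard = (2 * 𝓖.card + 1 : ℕ) := by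
    rw [encard_union_eq (disjoint_singleton_right.2 hzG), hc]
    simp
  rw [← hUfin.cast_ncard_eq] at hUc
  rw [← hCfin.cast_ncard_eq] at hCc
  norm_cast at hUc hCc
  have hdiff := ncard_sdiff_add_ncard_of_subset hsub hCfin
  -- The `t - 1` pairs and `z` account for `2t - 1` of the `2t` elements of `C`.
  obtain ⟨w, hw⟩ := ncard_eq_one.1 (show (C \ (⋃₀ (𝓖 : Set (Set α)) ∪ {z})).ncard = 1 by omega)
  have hwm : w ∈ C \ (⋃₀ (𝓖 : Set (Set α)) ∪ {z}) := hw ▸ mem_singleton w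
  obtain ⟨hwC, hwn⟩ := hwm
  rw [mem_union, not_or] at hwn
  refine ⟨w, hwn.2, ?_, ?_⟩
  · rintro ⟨q, hq, hwq⟩
    have hqC : q ⊆ C := hl q hq C hC (by rw [← hCfin.cast_ncard_eq, hCc]) ⟨w, hwC, hwq⟩
    have hqw : q ⊆ {w} := by
      intro y hy
      by_contra hyw
      rw [← hw] at hyw
      refine hyw ⟨hqC hy, ?_⟩
      rintro (⟨p, hp, hyp⟩ | rfl)
      · obtain rfl := h.pairwiseDisjoint.elim_set hq (h𝓖 hp) y hy hyp
        exact hwn.1 ⟨q, hp, hwq⟩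
      · exact hz ⟨q, hq, hy⟩
    have := encard_le_encard hqw
    rw [h.encard_eq_two q hq, encard_singleton] at this
    norm_num at this
  · have : {z, w} ∪ ⋃₀ (𝓖 : Set (Set α)) = C := by
      rw [← union_sdiff_cancel hsub, hw]
      ext y
      simp only [mem_union, mem_insert_iff, mem_singleton_iff]
      tauto
    rwa [this]

/-- As the two subfamilies are disjoint, the circuit and the cocircuit share `z` and could share a
second element only if `w = w'`. -/
lemma IsSpikeFamily.partner_eq {𝓖' : Finset (Set α)} (h : M.IsSpikeFamily t 𝓕) (h𝓖 : 𝓖 ⊆ 𝓕)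
    (h𝓖' : 𝓖' ⊆ 𝓕) (hd : Disjoint 𝓖 𝓖') {z w w' : α} (hz : z ∉ ⋃₀ (𝓕 : Set (Set α)))
    (hw : w ∉ ⋃₀ (𝓕 : Set (Set α))) (hw' : w' ∉ ⋃₀ (𝓕 : Set (Set α)))
    (hC : M.IsCircuit ({z, w} ∪ ⋃₀ (𝓖 : Set (Set α))))
    (hK : M.IsCocircuit ({z, w'} ∪ ⋃₀ (𝓖' : Set (Set α)))) : w = w' := by
  by_contra hne
  obtain ⟨u, hu, huz⟩ := (hC.isCocircuit_inter_nontrivial hK ⟨z, by simp⟩).exists_ne z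
  have hmem : ∀ 𝓗 ⊆ 𝓕, u ∈ ⋃₀ (𝓗 : Set (Set α)) → u ∈ ⋃₀ (𝓕 : Set (Set α)) :=
    fun 𝓗 h𝓗 hu => sUnion_mono (by simpa using h𝓗) hu
  obtain ⟨(rfl | rfl) | hu1, (hu2 | hu2) | hu2⟩ := hu
  · exact huz rfl
  · exact huz rfl
  · exact huz rfl
  · exact huz hu2
  · exact hne hu2
  · exact hw (hmem _ h𝓖' hu2)
  · exact huz hu2
  · rw [mem_singleton_iff.1 hu2] at hu1 hmem
    exact hw' (hmem _ h𝓖 hu1)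
  · obtain ⟨p, hp, hup⟩ := hu1
    obtain ⟨q, hq, huq⟩ := hu2
    obtain rfl := h.pairwiseDisjoint.elim_set (h𝓖 hp) (h𝓖' hq) u hup huq
    exact Finset.disjoint_left.1 hd hp hq

/-- The partner of `z` is the same for all subfamilies of `t - 1` pairs, for circuits and cocircuits
alike: any two subfamilies are compared through a third one disjoint from both, which exists because
`3(t - 1) ≤ 3t`. -/
lemma IsSpikeFamily.exists_insert (h : M.IsSpikeFamily t 𝓕) (ht : 1 ≤ t)
    (hcard : 3 * t ≤ 𝓕.card)
    (hC : ∀ X ⊆ M.E, X.encard = t → ∃ C, M.IsCircuit C ∧ C.encard = (2 * t : ℕ) ∧ X ⊆ C)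
    (hK : ∀ X ⊆ M.E, X.encard = t → ∃ K, M.IsCocircuit K ∧ K.encard = (2 * t : ℕ) ∧ X ⊆ K)
    {z : α} (hzE : z ∈ M.E) (hz : z ∉ ⋃₀ (𝓕 : Set (Set α))) :
    ∃ 𝓖, 𝓕 ⊂ 𝓖 ∧ M.IsSpikeFamily t 𝓖 := by
  classical
  have hP : ∀ 𝓖 ⊆ 𝓕, 𝓖.card + 1 = t → ∃ w, w ≠ z ∧ w ∉ ⋃₀ (𝓕 : Set (Set α)) ∧
      M.IsCircuit ({z, w} ∪ ⋃₀ (𝓖 : Set (Set α))) := fun 𝓖 h𝓖 hc =>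
    h.exists_partner ht hcard hC hzE hz h𝓖 hc
  have hQ : ∀ 𝓖 ⊆ 𝓕, 𝓖.card + 1 = t → ∃ w, w ≠ z ∧ w ∉ ⋃₀ (𝓕 : Set (Set α)) ∧
      M.IsCocircuit ({z, w} ∪ ⋃₀ (𝓖 : Set (Set α))) := fun 𝓖 h𝓖 hc =>
    h.dual.exists_partner ht hcard hK hzE hz h𝓖 hc
  have havoid : ∀ 𝓖 ⊆ 𝓕, ∀ 𝓗 ⊆ 𝓕, 𝓖.card + 1 = t → 𝓗.card + 1 = t →
      ∃ 𝓘 ⊆ 𝓕, 𝓘.card + 1 = t ∧ Disjoint 𝓖 𝓘 ∧ Disjoint 𝓗 𝓘 := by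
    intro 𝓖 h𝓖 𝓗 h𝓗 hG hH
    have h1 := Finset.card_union_le 𝓖 𝓗
    have h2 := Finset.card_sdiff_of_subset (Finset.union_subset h𝓖 h𝓗)
    obtain ⟨𝓘, h𝓘, hI⟩ := Finset.exists_subset_card_eq (s := 𝓕 \ (𝓖 ∪ 𝓗)) (n := t - 1) (by omega)
    have hd : Disjoint (𝓖 ∪ 𝓗) 𝓘 := Finset.disjoint_sdiff.mono_right h𝓘
    rw [Finset.disjoint_union_left] at hd
    exact ⟨𝓘, h𝓘.trans Finset.sdiff_subset, by omega, hd⟩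
  obtain ⟨𝓖₀, h𝓖₀, hc₀⟩ := Finset.exists_subset_card_eq (s := 𝓕) (n := t - 1) (by omega)
  obtain ⟨w, hwz, hw, hcw⟩ := hP 𝓖₀ h𝓖₀ (by omega)
  have hPw : ∀ 𝓖 ⊆ 𝓕, 𝓖.card + 1 = t → M.IsCircuit ({z, w} ∪ ⋃₀ (𝓖 : Set (Set α))) := by
    intro 𝓖 h𝓖 hG
    obtain ⟨𝓘, h𝓘, hI, hd, hd₀⟩ := havoid 𝓖 h𝓖 𝓖₀ h𝓖₀ hG (by omega)
    obtain ⟨u, -, hu, hcu⟩ := hP 𝓖 h𝓖 hG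
    obtain ⟨v, -, hv, hcv⟩ := hQ 𝓘 h𝓘 hI
    rwa [h.partner_eq h𝓖₀ h𝓘 hd₀ hz hw hv hcw hcv, ← h.partner_eq h𝓖 h𝓘 hd hz hu hv hcu hcv]
  have hQw : ∀ 𝓖 ⊆ 𝓕, 𝓖.card + 1 = t → M.IsCocircuit ({z, w} ∪ ⋃₀ (𝓖 : Set (Set α))) := by
    intro 𝓖 h𝓖 hG
    obtain ⟨𝓘, h𝓘, hI, hd, -⟩ := havoid 𝓖 h𝓖 𝓖 h𝓖 hG hG
    obtain ⟨v, -, hv, hcv⟩ := hQ 𝓖 h𝓖 hG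
    rwa [h.partner_eq h𝓘 h𝓖 hd.symm hz hw hv (hPw 𝓘 h𝓘 hI) hcv]
  have hnew : ({z, w} : Set α) ∉ 𝓕 := fun hmem => hz ⟨_, hmem, by simp⟩
  -- Stated for arbitrary `N` so as to serve both `M` and `M✶`.
  have hext : ∀ N : Matroid α,
      (∀ 𝓖 ⊆ 𝓕, 𝓖.card = t → N.IsCircuit (⋃₀ (𝓖 : Set (Set α)))) →
      (∀ 𝓖 ⊆ 𝓕, 𝓖.card + 1 = t → N.IsCircuit ({z, w} ∪ ⋃₀ (𝓖 : Set (Set α)))) →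
      ∀ 𝓖 ⊆ insert {z, w} 𝓕, 𝓖.card = t → N.IsCircuit (⋃₀ (𝓖 : Set (Set α))) := by
    intro N h1 h2 𝓖 h𝓖 hG
    by_cases hmem : ({z, w} : Set α) ∈ 𝓖
    · rw [← Finset.insert_erase hmem, Finset.coe_insert, sUnion_insert]
      refine h2 _ (Finset.subset_insert_iff.1 h𝓖) ?_
      rw [Finset.card_erase_of_mem hmem]
      omega
    · exact h1 𝓖 ((Finset.subset_insert_iff_of_notMem hmem).1 h𝓖) hG
  have hwE : w ∈ M.E := hcw.subset_ground (by simp)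
  refine ⟨insert {z, w} 𝓕, Finset.ssubset_insert hnew, ?_, ?_, ?_, hext M h.isCircuit hPw,
    hext M✶ h.isCocircuit hQw⟩
  · rw [Finset.coe_insert]
    refine h.pairwiseDisjoint.insert fun p hp _ => ?_
    rw [id, id, disjoint_left]
    rintro y (rfl | rfl) hyp
    exacts [hz ⟨p, hp, hyp⟩, hw ⟨p, hp, hyp⟩]
  · intro p hp
    rcases Finset.mem_insert.1 hp with rfl | hp
    exacts [pair_subset hzE hwE, h.subset_ground p hp]
  · intro p hp
    rcases Finset.mem_insert.1 hp with rfl | hp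
    exacts [encard_pair hwz.symm, h.encard_eq_two p hp]

lemma IsSpikeFamily.exists_sUnion_eq [M.Finite] (h : M.IsSpikeFamily t 𝓕) (ht : 1 ≤ t)
    (hcard : 3 * t ≤ 𝓕.card)
    (hC : ∀ X ⊆ M.E, X.encard = t → ∃ C, M.IsCircuit C ∧ C.encard = (2 * t : ℕ) ∧ X ⊆ C)
    (hK : ∀ X ⊆ M.E, X.encard = t → ∃ K, M.IsCocircuit K ∧ K.encard = (2 * t : ℕ) ∧ X ⊆ K) :
    ∃ 𝓖, 𝓕 ⊆ 𝓖 ∧ M.IsSpikeFamily t 𝓖 ∧ ⋃₀ (𝓖 : Set (Set α)) = M.E := by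
  have hfin : {𝓖 | 𝓕 ⊆ 𝓖 ∧ M.IsSpikeFamily t 𝓖}.Finite := by
    refine (M.ground_finite.powerset.toFinset.powerset.finite_toSet).subset ?_
    rintro 𝓖 ⟨-, h𝓖⟩
    simp only [Finset.coe_powerset, mem_preimage, mem_powerset_iff]
    intro p hp
    simpa using h𝓖.subset_ground p hp
  obtain ⟨𝓖, ⟨h𝓕𝓖, h𝓖⟩, hmax⟩ := hfin.exists_maximal ⟨𝓕, Finset.Subset.rfl, h⟩
  refine ⟨𝓖, h𝓕𝓖, h𝓖, (sUnion_subset h𝓖.subset_ground).antisymm fun z hz => ?_⟩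
  by_contra hzG
  obtain ⟨𝓗, hGH, h𝓗⟩ :=
    h𝓖.exists_insert ht (hcard.trans (Finset.card_le_card h𝓕𝓖)) hC hK hz hzG
  exact hGH.2 (hmax ⟨h𝓕𝓖.trans hGH.1, h𝓗⟩ hGH.1)

lemma IsSpikeFamily.isTSpike (h : M.IsSpikeFamily t 𝓕) (hcard : t ≤ 𝓕.card)
    (hU : ⋃₀ (𝓕 : Set (Set α)) = M.E) : M.IsTSpike t := by
  classical
  let e := 𝓕.equivFin
  let A : Fin 𝓕.card → Set α := fun i => (e.symm i).1
  have hmem : ∀ i, A i ∈ 𝓕 := fun i => (e.symm i).2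
  have hinj : Function.Injective A := Subtype.val_injective.comp e.symm.injective
  have key : ∀ N : Matroid α, N.IsSpikeFamily t 𝓕 → N.IsEchidna t 𝓕.card A := by
    intro N hN
    refine ⟨fun i => hN.subset_ground _ (hmem i), fun i j hij => ?_,
      fun i => hN.encard_eq_two _ (hmem i), fun I hI => ?_⟩
    · exact hN.pairwiseDisjoint (hmem i) (hmem j) (hinj.ne hij)
    · have := hN.isCircuit (I.image A) (Finset.image_subset_iff.2 fun i _ => hmem i)
        (by rw [Finset.card_image_of_injective _ hinj, hI])
      rwa [Finset.coe_image, sUnion_image] at this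
  refine ⟨𝓕.card, hcard, A, ?_, key M h, key M✶ h.dual⟩
  rw [← hU]
  refine subset_antisymm (iUnion_subset fun i => subset_sUnion_of_mem (hmem i)) ?_
  rintro y ⟨p, hp, hyp⟩
  exact mem_iUnion.2 ⟨e ⟨p, hp⟩, by simpa [A] using hyp⟩

lemma isTSpike_of_linkedPairsBound_le [M.Finite] (ht : 1 ≤ t)
    (h : M.HasCircuitCocircuitProperty t (2 * t)) (hE : linkedPairsBound t (3 * t) ≤ M.E.ncard) :
    M.IsTSpike t := by
  have hC : ∀ X ⊆ M.E, X.encard = t → ∃ C, M.IsCircuit C ∧ C.encard = (2 * t : ℕ) ∧ X ⊆ C :=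
    fun X hX hc => by simpa using (h X hX hc).1
  have hK : ∀ X ⊆ M.E, X.encard = t → ∃ K, M.IsCocircuit K ∧ K.encard = (2 * t : ℕ) ∧ X ⊆ K :=
    fun X hX hc => by simpa using (h X hX hc).2
  obtain ⟨𝓕, hcard, hdisj, hFE, h2, hl⟩ := exists_linked_pairs ht hC hK hE
  have hcirc : ∀ 𝓖 ⊆ 𝓕, 𝓖.card = t → M.IsCircuit (⋃₀ (𝓖 : Set (Set α))) := fun 𝓖 h𝓖 hc =>
    isCircuit_sUnion_of_isCircuitLinked hC (hdisj.subset (by simpa using h𝓖))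
      (fun p hp => hFE p (h𝓖 hp)) (fun p hp => h2 p (h𝓖 hp)) (fun p hp => hl p (h𝓖 hp)) hc
  have hcocirc : ∀ 𝓖 ⊆ 𝓕, 𝓖.card = t → M.IsCocircuit (⋃₀ (𝓖 : Set (Set α))) := fun 𝓖 h𝓖 hc =>
    isCircuit_sUnion_of_isCircuitLinked hK (hdisj.subset (by simpa using h𝓖))
      (fun p hp => hFE p (h𝓖 hp)) (fun p hp => h2 p (h𝓖 hp))
      (fun p hp => isCircuitLinked_dual ht hdisj h2 hcirc hcard (h𝓖 hp)) hc
  have hF : M.IsSpikeFamily t 𝓕 := ⟨hdisj, hFE, h2, hcirc, hcocirc⟩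
  obtain ⟨𝓖, h𝓖, hG, hU⟩ := hF.exists_sUnion_eq ht hcard hC hK
  have := Finset.card_le_card h𝓖
  exact hG.isTSpike (by omega) hU

end Matroid

theorem theorem1p1 :
    ∃ f : ℕ → ℕ, ∀ t : ℕ, 1 ≤ t →
      ∀ (α : Type*) (M : Matroid α), M.Finite →
        M.HasCircuitCocircuitProperty t (2 * t) → f t ≤ M.E.ncard → M.IsTSpike t :=
  ⟨fun t => Matroid.linkedPairsBound t (3 * t), fun _ ht _ _ _ h hE =>
    Matroid.isTSpike_of_linkedPairsBound_le ht h hE⟩
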